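/- All graphs are finite and simple, and $L(H)=D(H)-A(H)$ denotes the Laplacian matrix of a graph $H$ ($D(H)$ the diagonal matrix of vertex degrees, $A(H)$ the adjacency matrix). For an integer $g\ge 3$ and rooted trees $T_1,\dots,T_g$, each of order at least $1$, let $C(T_1,\dots,T_g)$ be the unicyclic graph obtained from the disjoint union of $T_1,\dots,T_g$ by joining their roots $v_1,\dots,v_g$, in this order, into a cycle of length $g$. Let $g_1,g_2\ge 3$, and let $G_1=C(T_1,\dots,T_{g_1})$ and $G_2=C(T'_1,\dots,T'_{g_2})$ be unicyclic graphs such that each of $G_1$, $G_2$ has a perfect matching and $2$ is an eigenvalue of both $L(G_1)$ and $L(G_2)$. Let $u\in V(G_1)$ and $v\in V(G_2)$ be arbitrary vertices, and let $G=G_1\odot G_2$ be the one-edge connection of $G_1$ and $G_2$, that is, the disjoint union of $G_1$ and $G_2$ together with the additional edge $uv$. Let $s_1$ be the number of indices $i\in\{1,\dots,g_1\}$ for which $T_i$ has odd order, and $s_2$ the number of indices $j\in\{1,\dots,g_2\}$ for which $T'_j$ has odd order. Then $$s_1\equiv s_2\equiv 0 \pmod 4 \quad\Longleftrightarrow\quad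 2 \text{ is an eigenvalue of } L(G).$$ -/

import Mathlib

/-- The graph `C(T₁, …, T_g)`: the disjoint union of the trees `T i` together with the edges of a
cycle of length `g` through their roots `r 0, r 1, …, r (g - 1)`, in this order.  For `3 ≤ g` and
trees `T i` this is the unicyclic graph in which `T i` is attached at the `i`-th cycle vertex. -/
def cycleOfTrees {g : ℕ} {V : Fin g → Type*} (T : ∀ i, SimpleGraph (V i)) (r : ∀ i, V i) :
    SimpleGraph (Σ i, V i) :=
  (⨆ i, (T i).map (Function.Embedding.sigmaMk i)) ⊔
    (SimpleGraph.cycleGraph g).map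
      (⟨fun i => ⟨i, r i⟩, fun _ _ h => congrArg Sigma.fst h⟩ : Fin g ↪ Σ i, V i)

/-- The one-edge connection `G₁ ⊙ G₂`: the disjoint union of `G₁` and `G₂` with the additional
edge joining the vertex `u` of `G₁` to the vertex `v` of `G₂`. -/
def oneEdgeConnection {V W : Type*} (G₁ : SimpleGraph V) (G₂ : SimpleGraph W) (u : V) (v : W) :
    SimpleGraph (V ⊕ W) :=
  (G₁ ⊕g G₂) ⊔ SimpleGraph.edge (Sum.inl u) (Sum.inr v)

/-- The graph `G` has a perfect matching. -/
def HasPerfectMatching {V : Type*} (G : SimpleGraph V) : Prop :=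
  ∃ M : G.Subgraph, M.IsPerfectMatching

open Classical in
/-- The real number `μ` is an eigenvalue of the Laplacian matrix `L(G) = D(G) - A(G)`. -/
def HasLaplacianEigenvalue {V : Type*} [Fintype V] (G : SimpleGraph V) (μ : ℝ) : Prop :=
  Module.End.HasEigenvalue (Matrix.toLin' (G.lapMatrix ℝ)) μ

/-- The number of graphs in a finite family that have odd order, in terms of the vertex sets. -/
def numOddOrder {g : ℕ} (V : Fin g → Type*) [∀ i, Fintype (V i)] : ℕ :=
  (Finset.univ.filter fun i => Odd (Fintype.card (V i))).card

/-! Under the hypotheses both sides of the equivalence hold. For the eigenvalue of `G`, eigenvectors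
of the two pieces are scaled to agree at `u` and `v`, so the new edge contributes nothing. For the
congruences, fix a perfect matching. On each tree the sign function flipping exactly along matching
edges solves the equation for 2 away from the root, and on a tree such solutions are unique up to
scale (`IsTree.eq_mul_of_sign`). An eigenvector is thus governed by its root values, which satisfy a
recursion around the cycle with signs -1 on matched cycle edges. A nonzero solution excludes sign
product -1 (`prod_sign_ne_neg_one_of_cyclic_recursion`), so the number of matched cycle edges is
even. The trees of odd order are those at the ends of these disjoint edges, so their number is twice
an even number. -/

/-! ### Laplacian eigenvectors and gluing along an edge -/

open Classical in
/-- The value at `v` of the Laplacian of `G` applied to `x`, as a sum over all vertices. -/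
noncomputable def lapApply {V : Type*} [Fintype V] (G : SimpleGraph V) (x : V → ℝ) (v : V) : ℝ :=
  ∑ w, if G.Adj v w then x v - x w else 0

theorem hasLaplacianEigenvalue_iff {V : Type*} [Fintype V] (G : SimpleGraph V) (μ : ℝ) :
    HasLaplacianEigenvalue G μ ↔ ∃ x : V → ℝ, x ≠ 0 ∧ ∀ v, lapApply G x v = μ * x v := by
  classical
  have key : ∀ (x : V → ℝ) (v : V),
      Matrix.toLin' (G.lapMatrix ℝ) x v = lapApply G x v := by
    intro x v
    rw [Matrix.toLin'_apply, SimpleGraph.lapMatrix_mulVec_apply, lapApply, ← Finset.sum_filter,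
      Finset.sum_sub_distrib, Finset.sum_const, ← SimpleGraph.neighborFinset_eq_filter,
      SimpleGraph.card_neighborFinset_eq_degree, nsmul_eq_mul]
  unfold HasLaplacianEigenvalue
  constructor
  · intro h
    obtain ⟨x, hx⟩ := h.exists_hasEigenvector
    refine ⟨x, hx.2, fun v => ?_⟩
    have := congrFun hx.apply_eq_smul v
    rw [← key]
    simpa using this
  · rintro ⟨x, hx, h⟩
    refine Module.End.hasEigenvalue_of_hasEigenvector (x := x) ⟨?_, hx⟩
    rw [Module.End.mem_eigenspace_iff]
    ext v
    have := (key x v).trans (h v)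
    simpa using this

theorem lapApply_comp_iso {V W : Type*} [Fintype V] [Fintype W] {G : SimpleGraph V}
    {H : SimpleGraph W} (φ : G ≃g H) (x : V → ℝ) (w : W) :
    lapApply H (x ∘ φ.symm) w = lapApply G x (φ.symm w) := by
  classical
  unfold lapApply
  rw [← Equiv.sum_comp φ.symm.toEquiv]
  refine Finset.sum_congr rfl fun t _ => ?_
  have : G.Adj (φ.symm w) (φ.symm.toEquiv t) ↔ H.Adj w t := φ.symm.map_adj_iff
  simp only [this]
  rfl

/-- Two eigenvectors can be scaled so as to agree at the ends of the connecting edge. -/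
theorem HasLaplacianEigenvalue.oneEdgeConnection {V W : Type*} [Fintype V] [Fintype W]
    {G : SimpleGraph V} {H : SimpleGraph W} {μ : ℝ} (hG : HasLaplacianEigenvalue G μ)
    (hH : HasLaplacianEigenvalue H μ) (u : V) (v : W) :
    HasLaplacianEigenvalue (oneEdgeConnection G H u v) μ := by
  classical
  rw [hasLaplacianEigenvalue_iff] at hG hH ⊢
  obtain ⟨x, hx, hGx⟩ := hG
  obtain ⟨y, hy, hHy⟩ := hH
  -- If `x u = 0`, then `x` extended by zero works; otherwise cross-multiply, and the coefficient `x
  -- u` of `y` is nonzero.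
  obtain ⟨a, b, hab, h⟩ : ∃ a b : ℝ, (a ≠ 0 ∨ b ≠ 0) ∧ a * x u = b * y v := by
    by_cases h : x u = 0
    · exact ⟨1, 0, by simp, by simp [h]⟩
    · exact ⟨y v, x u, Or.inr h, mul_comm _ _⟩
  refine ⟨Sum.elim (a • x) (b • y), ?_, ?_⟩
  · intro h0
    rcases hab with ha | hb
    · refine hx (funext fun t => ?_)
      simpa [ha] using congrFun h0 (Sum.inl t)
    · refine hy (funext fun t => ?_)
      simpa [hb] using congrFun h0 (Sum.inr t)
  · rintro (t | t)
    · have h1 := congrArg (a * ·) (hGx t)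
      simp only [lapApply, Finset.mul_sum] at h1
      rw [lapApply, Fintype.sum_sum_type]
      have h2 : ∑ w : W, (if (_root_.oneEdgeConnection G H u v).Adj (Sum.inl t) (Sum.inr w) then
          Sum.elim (a • x) (b • y) (Sum.inl t) - Sum.elim (a • x) (b • y) (Sum.inr w) else 0)
          = 0 := by
        refine Finset.sum_eq_zero fun w _ => ?_
        split_ifs with hw
        · have : t = u ∧ w = v := by
            simpa [_root_.oneEdgeConnection, SimpleGraph.edge_adj] using hw
          simp [this.1, this.2, h]
        · rfl
      rw [h2, add_zero]
      simp only [_root_.oneEdgeConnection, SimpleGraph.sup_adj, SimpleGraph.edge_adj]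
      simp only [Sum.elim_inl, Pi.smul_apply, smul_eq_mul]
      refine Eq.trans (Finset.sum_congr rfl fun w _ => ?_) (h1.trans (by ring))
      simp [mul_sub, mul_ite]
    · have h1 := congrArg (b * ·) (hHy t)
      simp only [lapApply, Finset.mul_sum] at h1
      rw [lapApply, Fintype.sum_sum_type]
      have h2 : ∑ w : V, (if (_root_.oneEdgeConnection G H u v).Adj (Sum.inr t) (Sum.inl w) then
          Sum.elim (a • x) (b • y) (Sum.inr t) - Sum.elim (a • x) (b • y) (Sum.inl w) else 0)
          = 0 := by
        refine Finset.sum_eq_zero fun w _ => ?_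
        split_ifs with hw
        · have : t = v ∧ w = u := by
            simpa [_root_.oneEdgeConnection, SimpleGraph.edge_adj] using hw
          simp [this.1, this.2, h]
        · rfl
      rw [h2, zero_add]
      simp only [_root_.oneEdgeConnection, SimpleGraph.sup_adj, SimpleGraph.edge_adj]
      simp only [Sum.elim_inr, Pi.smul_apply, smul_eq_mul]
      refine Eq.trans (Finset.sum_congr rfl fun w _ => ?_) (h1.trans (by ring))
      simp [mul_sub, mul_ite]

/-! ### Signs and uniqueness of solutions on trees -/

/-- Signs prescribed on the edges of a tree are the coboundary of signs on its vertices. -/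
theorem SimpleGraph.IsTree.exists_sign {V : Type*} {T : SimpleGraph V} (hT : T.IsTree)
    (ε : V → V → ℝ) (hsymm : ∀ a b, ε a b = ε b a) (hε : ∀ a b, ε a b * ε a b = 1) :
    ∃ σ : V → ℝ, (∀ a, σ a * σ a = 1) ∧ ∀ a b, T.Adj a b → σ b = ε a b * σ a := by
  obtain ⟨r⟩ := hT.connected.nonempty
  -- The sign at `a` is the product of edge signs along the path from `r`; paths to adjacent
  -- vertices differ by the joining edge.
  choose p hp using fun a => (hT.existsUnique_path r a).exists
  let e : Sym2 V → ℝ := Sym2.lift ⟨ε, hsymm⟩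
  have he : ∀ z, e z * e z = 1 := fun z => by
    induction z with | _ a b => exact hε a b
  have hl : ∀ l : List (Sym2 V), (l.map e).prod * (l.map e).prod = 1 := by
    intro l
    induction l with
    | nil => simp
    | cons z l ih =>
      rw [List.map_cons, List.prod_cons, mul_mul_mul_comm, ih, he, one_mul]
  have hc : ∀ a b (h : T.Adj a b), a ∈ (p b).support →
      (((p b).edges.map e).prod : ℝ) = ε a b * ((p a).edges.map e).prod := by
    intro a b h hmem
    rw [hT.isAcyclic.path_concat (hp a) (hp b) h hmem]
    simp [SimpleGraph.Walk.edges_concat, e, mul_comm]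
  refine ⟨fun a => ((p a).edges.map e).prod, fun a => hl _, fun a b h => ?_⟩
  by_cases hb : b ∈ (p a).support
  · have := hc b a h.symm hb
    simp only [this]
    rw [← mul_assoc, hsymm b a, hε, one_mul]
  · exact hc a b h
      (hT.isAcyclic.mem_support_of_ne_mem_support_of_adj_of_isPath (hp b) (hp a) h.symm hb)

/-- Two functions with the same Laplacian eigenvalue on a set `K` that is left by a single edge
`vw` only have proportional values on that edge. -/
theorem mul_eq_mul_of_unique_boundary_edge {V : Type*} [Fintype V] {G : SimpleGraph V} {μ : ℝ}
    {x y : V → ℝ} {K : Set V} (hx : ∀ a ∈ K, lapApply G x a = μ * x a)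
    (hy : ∀ a ∈ K, lapApply G y a = μ * y a) {v w : V} (hvw : G.Adj v w) (hv : v ∈ K)
    (hw : w ∉ K) (hK : ∀ a ∈ K, ∀ b ∉ K, G.Adj a b → a = v ∧ b = w) :
    x v * y w = y v * x w := by
  classical
  -- A discrete Wronskian, viewed as a flow. The common eigenvalue makes its divergence vanish on
  -- `K` and antisymmetry cancels the flux inside `K`, so the flux through the only exit `vw` is
  -- zero.
  let F : V → V → ℝ := fun a b => if G.Adj a b then x a * y b - y a * x b else 0
  have hF : ∀ a b, F a b = - F b a := by
    intro a b
    simp only [F, G.adj_comm a b]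
    split_ifs <;> ring
  have hrow : ∀ a ∈ K, ∑ b, F a b = 0 := by
    intro a ha
    have : ∑ b, F a b = y a * lapApply G x a - x a * lapApply G y a := by
      simp only [lapApply, Finset.mul_sum, ← Finset.sum_sub_distrib]
      refine Finset.sum_congr rfl fun b _ => ?_
      simp only [F]
      split_ifs <;> ring
    rw [this, hx a ha, hy a ha]
    ring
  have hin : ∑ a, ∑ b, (if a ∈ K ∧ b ∈ K then F a b else 0) = 0 := by
    have h : ∑ a, ∑ b, (if a ∈ K ∧ b ∈ K then F a b else 0)
        = - ∑ a, ∑ b, (if a ∈ K ∧ b ∈ K then F a b else 0) := by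
      conv_lhs => rw [Finset.sum_comm]
      simp only [← Finset.sum_neg_distrib]
      refine Finset.sum_congr rfl fun a _ => Finset.sum_congr rfl fun b _ => ?_
      rw [hF b a]
      by_cases h1 : a ∈ K <;> by_cases h2 : b ∈ K <;> simp [h1, h2]
    linarith
  have hall : ∑ a, ∑ b, (if a ∈ K then F a b else 0) = 0 := by
    refine Finset.sum_eq_zero fun a _ => ?_
    split_ifs with h
    · exact hrow a h
    · simp
  have hout : ∑ a, ∑ b, (if a ∈ K ∧ b ∉ K then F a b else 0) = F v w := by
    rw [Finset.sum_eq_single v, Finset.sum_eq_single w]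
    · simp [hv, hw]
    · intro b _ hb
      split_ifs with h
      · exact if_neg fun hadj => hb (hK v h.1 b h.2 hadj).2
      · rfl
    · simp
    · intro a _ ha
      refine Finset.sum_eq_zero fun b _ => ?_
      split_ifs with h
      · exact if_neg fun hadj => ha (hK a h.1 b h.2 hadj).1
      · rfl
    · simp
  have hsplit : ∑ a, ∑ b, (if a ∈ K then F a b else 0)
      = ∑ a, ∑ b, (if a ∈ K ∧ b ∈ K then F a b else 0)
        + ∑ a, ∑ b, (if a ∈ K ∧ b ∉ K then F a b else 0) := by
    simp only [← Finset.sum_add_distrib]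
    refine Finset.sum_congr rfl fun a _ => Finset.sum_congr rfl fun b _ => ?_
    by_cases h1 : a ∈ K <;> by_cases h2 : b ∈ K <;> simp [h1, h2]
  rw [hall, hin, hout, zero_add] at hsplit
  simp only [F, if_pos hvw] at hsplit
  linarith

/-- On a tree, two functions satisfying the same Laplacian eigenvalue equation away from the root
are proportional along every edge. -/
theorem SimpleGraph.IsTree.mul_eq_mul_of_adj {V : Type*} [Fintype V] {T : SimpleGraph V}
    (hT : T.IsTree) (r : V) {μ : ℝ} {x y : V → ℝ} (hx : ∀ a, a ≠ r → lapApply T x a = μ * x a)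
    (hy : ∀ a, a ≠ r → lapApply T y a = μ * y a) {v w : V} (hvw : T.Adj v w) :
    x v * y w = y v * x w := by
  -- Every edge is a bridge; `K` is the side of `vw` that misses the root, where both equations
  -- hold.
  have main : ∀ v w, T.Adj v w → ¬ (T.deleteEdges {s(v, w)}).Reachable v r →
      x v * y w = y v * x w := by
    intro v w hvw hr
    have hbr := SimpleGraph.isAcyclic_iff_forall_adj_isBridge.1 hT.isAcyclic hvw
    rw [SimpleGraph.isBridge_iff] at hbr
    refine mul_eq_mul_of_unique_boundary_edge (G := T) (μ := μ)
      (K := {a | (T.deleteEdges {s(v, w)}).Reachable v a}) ?_ ?_ hvw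
      (SimpleGraph.Reachable.refl v) hbr ?_
    · rintro a ha
      exact hx a fun h => hr (h ▸ ha)
    · rintro a ha
      exact hy a fun h => hr (h ▸ ha)
    · intro a ha b hb hab
      have : s(a, b) = s(v, w) := by
        by_contra hne
        exact hb (ha.trans (SimpleGraph.Adj.reachable
          ((SimpleGraph.deleteEdges_adj).2 ⟨hab, by simpa using hne⟩)))
      rcases Sym2.eq_iff.1 this with h | ⟨rfl, rfl⟩
      · exact h
      · exact absurd ha hbr
  by_cases hr : (T.deleteEdges {s(v, w)}).Reachable v r
  · have hbr := SimpleGraph.isAcyclic_iff_forall_adj_isBridge.1 hT.isAcyclic hvw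
    rw [SimpleGraph.isBridge_iff] at hbr
    have := main w v hvw.symm (by
      rw [Sym2.eq_swap]
      exact fun h => hbr (hr.trans h.symm))
    linarith
  · exact main v w hvw hr

/-- Since `σ` squares to 1, proportionality along edges says that `x * σ` is constant on the tree.
-/
theorem SimpleGraph.IsTree.eq_mul_of_sign {V : Type*} [Fintype V] {T : SimpleGraph V}
    (hT : T.IsTree) (r : V) {μ : ℝ} {x σ : V → ℝ} (hx : ∀ a, a ≠ r → lapApply T x a = μ * x a)
    (hσ : ∀ a, a ≠ r → lapApply T σ a = μ * σ a) (hsq : ∀ a, σ a * σ a = 1) (a : V) :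
    x a = x r * σ r * σ a := by
  have hadj : ∀ v w, T.Adj v w → x v * σ v = x w * σ w := by
    intro v w h
    have h1 := hT.mul_eq_mul_of_adj r hx hσ h
    have h2 : x v * σ v = x v * σ w * (σ w * σ v) := by
      linear_combination (-(x v * σ v)) * hsq w
    rw [h2, h1]
    linear_combination (x w * σ w) * hsq v
  have hall : ∀ v w, T.Reachable v w → x v * σ v = x w * σ w := by
    rintro v w ⟨p⟩
    induction p with
    | nil => rfl
    | cons h _ ih => exact (hadj _ _ h).trans ih
  have := hall a r (hT.connected.preconnected a r)
  linear_combination σ a * this - x a * hsq a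

/-! ### The signed recursion around a cycle -/

open Fin.NatCast Fin.CommRing in
/-- The recursion `x (i + 2) + x i = (ε i + ε (i + 1)) * x (i + 1)` around a cycle, with signs `ε`,
has a nonzero solution only if the product of the signs is `1`. -/
theorem prod_sign_ne_neg_one_of_cyclic_recursion {n : ℕ} {x ε : Fin (n + 1) → ℝ}
    (hε : ∀ i, ε i * ε i = 1) (hrec : ∀ i, x (i + 1 + 1) + x i = (ε i + ε (i + 1)) * x (i + 1))
    (hx : x ≠ 0) : ∏ i, ε i ≠ -1 := by
  intro hprod
  have hcast : (Nat.cast (n + 1) : Fin (n + 1)) = (0 : Fin (n + 1)) := Fin.natCast_self _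
  let S : ℕ → ℝ := fun k => ∏ j ∈ Finset.range k, ε (j : Fin (n + 1))
  -- The recursion conserves `f`, while one turn around the cycle multiplies it by the total sign
  -- -1; hence `f = 0`. Then `x` itself is transported by the signs, and a second turn forces `x 0 =
  -- 0`.
  let f : ℕ → ℝ := fun k => S k * (x ((k : Fin (n + 1)) + 1) - ε k * x k)
  have hS : S (n + 1) = -1 := by
    simp only [S]
    rw [← hprod, ← Fin.prod_univ_eq_prod_range (fun j => ε ((j : ℕ) : Fin (n + 1)))]
    simp
  have hS1 : ∀ k, S (k + 1) = S k * ε k := fun k => Finset.prod_range_succ _ _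
  have hS0 : S 0 = 1 := Finset.prod_range_zero _
  have hSne : ∀ k, S k ≠ 0 := fun k => Finset.prod_ne_zero_iff.2 fun j _ h => by
    simpa [h] using hε (j : Fin (n + 1))
  have hf1 : ∀ k, f (k + 1) = f k := by
    intro k
    simp only [f, hS1, Nat.cast_add, Nat.cast_one]
    linear_combination S k * ε k * hrec k + S k * x (k + 1) * hε k
  have hfc : ∀ k, f k = f 0 := fun k => by
    induction k with
    | zero => rfl
    | succ k ih => rw [hf1, ih]
  have hf0 : f 0 = 0 := by
    have h := hfc (n + 1)
    have h2 : f (n + 1) = - f 0 := by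
      simp only [f, hS, hS0, hcast, Nat.cast_zero]
      ring
    linarith
  have hstep : ∀ k : ℕ, x ((k : Fin (n + 1)) + 1) = ε k * x k := fun k => by
    have h : S k * (x ((k : Fin (n + 1)) + 1) - ε k * x k) = 0 := (hfc k).trans hf0
    have := (mul_eq_zero.1 h).resolve_left (hSne k)
    linarith
  have hxk : ∀ k : ℕ, x k = S k * x 0 := fun k => by
    induction k with
    | zero => simp [hS0]
    | succ k ih =>
      rw [Nat.cast_add, Nat.cast_one, hstep, ih, hS1]
      ring
  have hx0 : x 0 = 0 := by
    have h := hxk (n + 1)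
    rw [hcast, hS] at h
    linarith
  refine hx (funext fun i => ?_)
  have h := hxk i
  rw [hx0, mul_zero] at h
  simpa using h

/-! ### The Laplacian of a cycle of trees -/

theorem cycleOfTrees_adj_iff {g : ℕ} {V : Fin g → Type*} (T : ∀ i, SimpleGraph (V i))
    (r : ∀ i, V i) (p q : Σ i, V i) : (cycleOfTrees T r).Adj p q ↔
      (∃ i a b, (T i).Adj a b ∧ p = ⟨i, a⟩ ∧ q = ⟨i, b⟩) ∨
        ∃ i j, (SimpleGraph.cycleGraph g).Adj i j ∧ p = ⟨i, r i⟩ ∧ q = ⟨j, r j⟩ := by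
  simp only [cycleOfTrees, SimpleGraph.sup_adj, SimpleGraph.iSup_adj, SimpleGraph.map_adj]
  simp only [Function.Embedding.sigmaMk_apply, @eq_comm _ _ p, @eq_comm _ _ q]
  rfl

theorem cycleOfTrees_adj_same {g : ℕ} {V : Fin g → Type*} (T : ∀ i, SimpleGraph (V i))
    (r : ∀ i, V i) (i : Fin g) (a b : V i) :
    (cycleOfTrees T r).Adj ⟨i, a⟩ ⟨i, b⟩ ↔ (T i).Adj a b := by
  rw [cycleOfTrees_adj_iff]
  constructor
  · rintro (⟨j, a', b', h, h1, h2⟩ | ⟨j, k, h, h1, h2⟩)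
    · obtain rfl : i = j := congrArg Sigma.fst h1
      rwa [eq_of_heq (Sigma.mk.inj h1).2, eq_of_heq (Sigma.mk.inj h2).2]
    · obtain rfl : i = j := congrArg Sigma.fst h1
      obtain rfl : i = k := congrArg Sigma.fst h2
      exact absurd h (SimpleGraph.irrefl _)
  · exact fun h => Or.inl ⟨i, a, b, h, rfl, rfl⟩

theorem cycleOfTrees_adj_of_ne {g : ℕ} {V : Fin g → Type*} (T : ∀ i, SimpleGraph (V i))
    (r : ∀ i, V i) {i j : Fin g} (hij : i ≠ j) (a : V i) (b : V j) :
    (cycleOfTrees T r).Adj ⟨i, a⟩ ⟨j, b⟩ ↔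
      a = r i ∧ b = r j ∧ (SimpleGraph.cycleGraph g).Adj i j := by
  rw [cycleOfTrees_adj_iff]
  constructor
  · rintro (⟨k, a', b', h, h1, h2⟩ | ⟨k, l, h, h1, h2⟩)
    · exact absurd ((congrArg Sigma.fst h1).trans (congrArg Sigma.fst h2).symm) hij
    · obtain rfl : i = k := congrArg Sigma.fst h1
      obtain rfl : j = l := congrArg Sigma.fst h2
      exact ⟨eq_of_heq (Sigma.mk.inj h1).2, eq_of_heq (Sigma.mk.inj h2).2, h⟩
  · rintro ⟨rfl, rfl, h⟩
    exact Or.inr ⟨i, j, h, rfl, rfl⟩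

/-- Length at least 3 makes the two cycle neighbours of a root distinct. -/
theorem fin_sub_one_ne_add_one {n : ℕ} (i : Fin (n + 3)) : i - 1 ≠ i + 1 := by
  intro h
  have h2 : (1 + 1 : Fin (n + 3)) = 0 :=
    calc (1 + 1 : Fin (n + 3)) = i + 1 - (i - 1) := by abel
      _ = 0 := sub_eq_zero.2 h.symm
  have h3 : 2 % (n + 3) = 0 := by simpa [Fin.ext_iff, Fin.val_add] using h2
  rw [Nat.mod_eq_of_lt (by omega)] at h3
  omega

theorem lapApply_cycleGraph {n : ℕ} (y : Fin (n + 3) → ℝ) (i : Fin (n + 3)) :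
    lapApply (SimpleGraph.cycleGraph (n + 3)) y i = 2 * y i - y (i + 1) - y (i - 1) := by
  classical
  have h : ∀ j, (SimpleGraph.cycleGraph (n + 3)).Adj i j ↔ j ∈ ({i - 1, i + 1} : Finset _) := by
    intro j
    rw [← SimpleGraph.cycleGraph_neighborFinset, SimpleGraph.mem_neighborFinset]
  simp only [lapApply, h, Finset.sum_ite_mem, Finset.univ_inter]
  rw [Finset.sum_pair (fin_sub_one_ne_add_one i)]
  ring

open Classical in
theorem lapApply_cycleOfTrees {n : ℕ} {V : Fin (n + 3) → Type*} [∀ i, Fintype (V i)]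
    (T : ∀ i, SimpleGraph (V i)) (r : ∀ i, V i) (x : (Σ i, V i) → ℝ) (i : Fin (n + 3)) (a : V i) :
    lapApply (cycleOfTrees T r) x ⟨i, a⟩ = lapApply (T i) (fun b => x ⟨i, b⟩) a +
      if a = r i then 2 * x ⟨i, r i⟩ - x ⟨i + 1, r (i + 1)⟩ - x ⟨i - 1, r (i - 1)⟩ else 0 := by
  have hj : ∀ j, (∑ b : V j, if (cycleOfTrees T r).Adj ⟨i, a⟩ ⟨j, b⟩ then
      x ⟨i, a⟩ - x ⟨j, b⟩ else 0) = (if j = i then lapApply (T i) (fun b => x ⟨i, b⟩) a else 0) +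
        if a = r i then (if (SimpleGraph.cycleGraph (n + 3)).Adj i j then
          x ⟨i, r i⟩ - x ⟨j, r j⟩ else 0) else 0 := by
    intro j
    by_cases h : j = i
    · subst h
      simp [cycleOfTrees_adj_same, lapApply]
    · simp only [cycleOfTrees_adj_of_ne T r (Ne.symm h), if_neg h, zero_add]
      rw [Finset.sum_eq_single (r j) (fun b _ hb => if_neg fun hh => hb hh.2.1) (by simp)]
      by_cases ha : a = r i
      · subst ha; simp
      · simp [ha]
  rw [← lapApply_cycleGraph (fun j => x ⟨j, r j⟩), lapApply, Fintype.sum_sigma]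
  simp only [hj, Finset.sum_add_distrib, Finset.sum_ite_eq', Finset.mem_univ, if_true]
  congr 1
  by_cases ha : a = r i <;> simp [ha, lapApply]

/-! ### Perfect matchings and the parity of the trees -/

theorem HasPerfectMatching.exists_involution {V : Type*} {G : SimpleGraph V}
    (h : HasPerfectMatching G) : ∃ m : V → V, (∀ v, G.Adj v (m v)) ∧ ∀ v, m (m v) = v := by
  obtain ⟨M, hM⟩ := h
  rw [SimpleGraph.Subgraph.isPerfectMatching_iff] at hM
  choose m hm hu using hM
  exact ⟨m, fun v => (hm v).adj_sub, fun v => (hu _ _ (hm v).symm).symm⟩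

theorem lapApply_const_mul {V : Type*} [Fintype V] (G : SimpleGraph V) (c : ℝ) (x : V → ℝ)
    (v : V) : lapApply G (fun w => c * x w) v = c * lapApply G x v := by
  simp only [lapApply, Finset.mul_sum]
  refine Finset.sum_congr rfl fun w _ => ?_
  split_ifs <;> ring

section Matching

variable {n : ℕ} {V : Fin (n + 3) → Type*} {T : ∀ i, SimpleGraph (V i)}
  {r : ∀ i, V i} {m : (Σ i, V i) → Σ i, V i}

theorem fst_matching_eq_of_ne_root (hm : ∀ p, (cycleOfTrees T r).Adj p (m p)) {i : Fin (n + 3)}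
    {a : V i} (ha : a ≠ r i) : (m ⟨i, a⟩).1 = i := by
  by_contra h
  have h1 := hm ⟨i, a⟩
  generalize m ⟨i, a⟩ = q at h h1
  obtain ⟨j, b⟩ := q
  exact ha ((cycleOfTrees_adj_of_ne T r (Ne.symm h) a b).1 h1).1

/-- A root whose partner lies in another tree is matched to a neighbouring root of the cycle. -/
theorem fst_matching_root_ne_iff (hm : ∀ p, (cycleOfTrees T r).Adj p (m p))
    (hinv : ∀ p, m (m p) = p) (i : Fin (n + 3)) : (m ⟨i, r i⟩).1 ≠ i ↔
      m ⟨i, r i⟩ = ⟨i + 1, r (i + 1)⟩ ∨ m ⟨i - 1, r (i - 1)⟩ = ⟨i, r i⟩ := by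
  constructor
  · intro h
    have h1 := hm ⟨i, r i⟩
    have h2 := hinv ⟨i, r i⟩
    generalize m ⟨i, r i⟩ = q at h h1 h2 ⊢
    obtain ⟨j, b⟩ := q
    obtain ⟨-, hb, h3⟩ := (cycleOfTrees_adj_of_ne T r (Ne.symm h) _ b).1 h1
    obtain rfl : b = r j := hb
    change (SimpleGraph.cycleGraph (n + 3)).Adj i j at h3
    rw [SimpleGraph.cycleGraph_adj] at h3
    rcases h3 with h3 | h3
    · obtain rfl : j = i - 1 := by rw [← h3]; abel
      exact Or.inr h2
    · obtain rfl : j = i + 1 := by rw [← h3]; abel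
      exact Or.inl rfl
  · rintro (h | h)
    · simp [h]
    · rw [← h, hinv]
      simp

theorem not_matching_root_both (hinv : ∀ p, m (m p) = p) (i : Fin (n + 3))
    (h : m ⟨i, r i⟩ = ⟨i + 1, r (i + 1)⟩) : m ⟨i - 1, r (i - 1)⟩ ≠ ⟨i, r i⟩ := by
  intro h'
  have h2 := hinv ⟨i - 1, r (i - 1)⟩
  rw [h', h] at h2
  exact fin_sub_one_ne_add_one i (congrArg Sigma.fst h2).symm

/-- Only the root can be matched outside its tree; the vertices matched inside come in pairs. -/
theorem odd_card_iff_fst_matching_root_ne [∀ i, Fintype (V i)] (hm : ∀ p, (cycleOfTrees T r).Adj p (m p))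
    (hinv : ∀ p, m (m p) = p) (i : Fin (n + 3)) :
    Odd (Fintype.card (V i)) ↔ (m ⟨i, r i⟩).1 ≠ i := by
  classical
  let s : Finset (Σ i, V i) := Finset.univ.filter fun p => p.1 = i ∧ (m p).1 = i
  have hs : Even s.card := by
    rw [← ZMod.natCast_eq_zero_iff_even]
    have : ∑ p ∈ s, (1 : ZMod 2) = 0 := by
      refine Finset.sum_involution (fun p _ => m p) (fun _ _ => by decide)
        (fun p _ _ => (hm p).ne') (fun p hp => ?_) (fun p _ => hinv p)
      simp only [s, Finset.mem_filter, Finset.mem_univ, true_and, hinv] at hp ⊢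
      exact hp.symm
    simpa using this
  let t : Finset (Σ i, V i) := Finset.univ.filter fun p => p.1 = i
  have ht : t.card = Fintype.card (V i) := by
    rw [← Finset.card_univ, ← Finset.card_map (Function.Embedding.sigmaMk i)]
    congr 1
    ext ⟨j, a⟩
    simp only [t, Finset.mem_filter, Finset.mem_univ, true_and, Finset.mem_map,
      Function.Embedding.sigmaMk_apply]
    constructor
    · rintro rfl; exact ⟨a, rfl⟩
    · rintro ⟨b, h⟩; exact (congrArg Sigma.fst h).symm
  rw [← ht]
  by_cases h : (m ⟨i, r i⟩).1 = i
  · have : t = s := by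
      ext ⟨j, a⟩
      simp only [t, s, Finset.mem_filter, Finset.mem_univ, true_and, iff_self_and]
      rintro rfl
      by_cases ha : a = r j
      · rwa [ha]
      · exact fst_matching_eq_of_ne_root hm ha
    rw [this]
    simp [h, hs]
  · have : t = insert ⟨i, r i⟩ s := by
      ext ⟨j, a⟩
      simp only [t, s, Finset.mem_filter, Finset.mem_univ, true_and, Finset.mem_insert]
      constructor
      · rintro rfl
        by_cases ha : a = r j
        · exact Or.inl (by rw [ha])
        · exact Or.inr ⟨rfl, fst_matching_eq_of_ne_root hm ha⟩
      · rintro (h1 | h1)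
        · exact congrArg Sigma.fst h1
        · exact h1.1
    rw [this, Finset.card_insert_of_notMem (by simp [s, h])]
    simp [h, hs.add_one]

open Classical in
/-- On each tree there is a sign function that changes sign exactly along the matching edges. -/
theorem exists_sign_of_matching [∀ i, Fintype (V i)] (hT : ∀ i, (T i).IsTree)
    (hm : ∀ p, (cycleOfTrees T r).Adj p (m p)) (hinv : ∀ p, m (m p) = p) (i : Fin (n + 3)) :
    ∃ σ : V i → ℝ, (∀ a, σ a * σ a = 1) ∧
      ∀ a, lapApply (T i) σ a = if (m ⟨i, a⟩).1 = i then 2 * σ a else 0 := by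
  obtain ⟨σ, hsq, hσ⟩ := (hT i).exists_sign
    (fun a b => if m ⟨i, a⟩ = ⟨i, b⟩ then (-1 : ℝ) else 1)
    (fun a b => by
      have : m ⟨i, a⟩ = ⟨i, b⟩ ↔ m ⟨i, b⟩ = ⟨i, a⟩ :=
        ⟨fun h => by rw [← h, hinv], fun h => by rw [← h, hinv]⟩
      simp only [this])
    (fun a b => by split_ifs <;> norm_num)
  refine ⟨σ, hsq, fun a => ?_⟩
  -- Only the matching partner has the opposite sign, so it alone contributes, and it gives `2 * σ
  -- a`.
  have hterm : ∀ b, (if (T i).Adj a b then σ a - σ b else 0)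
      = if m ⟨i, a⟩ = ⟨i, b⟩ then 2 * σ a else 0 := by
    intro b
    by_cases hb : m ⟨i, a⟩ = ⟨i, b⟩
    · have hab : (T i).Adj a b := by
        rw [← cycleOfTrees_adj_same T r, ← hb]
        exact hm _
      rw [if_pos hab, hσ a b hab, if_pos hb, if_pos hb]
      ring
    · rw [if_neg hb]
      split_ifs with hab
      · rw [hσ a b hab, if_neg hb]
        ring
      · rfl
  rw [lapApply]
  simp only [hterm]
  generalize m ⟨i, a⟩ = q
  obtain ⟨j, c⟩ := q
  by_cases hj : j = i
  · subst hj
    simp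
  · rw [if_neg hj]
    exact Finset.sum_eq_zero fun b _ => if_neg fun h => hj (congrArg Sigma.fst h)

/-- The cycle of trees has an eigenvector for `2` only if an even number of edges of the cycle
are in the perfect matching, and each such edge joins the roots of two trees of odd order. -/
theorem numOddOrder_modEq_zero [∀ i, Fintype (V i)] (hT : ∀ i, (T i).IsTree)
    (hm : ∀ p, (cycleOfTrees T r).Adj p (m p)) (hinv : ∀ p, m (m p) = p) {x : (Σ i, V i) → ℝ}
    (hx : x ≠ 0) (hLx : ∀ p, lapApply (cycleOfTrees T r) x p = 2 * x p) :
    numOddOrder V ≡ 0 [MOD 4] := by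
  classical
  choose σ hsq hσ using exists_sign_of_matching hT hm hinv
  have hprop : ∀ i a, x ⟨i, a⟩ = x ⟨i, r i⟩ * σ i (r i) * σ i a := by
    intro i a
    refine (hT i).eq_mul_of_sign (r i) (μ := 2) (x := fun b => x ⟨i, b⟩) (fun b hb => ?_)
      (fun b hb => ?_) (hsq i) a
    · have := hLx ⟨i, b⟩
      rwa [lapApply_cycleOfTrees, if_neg hb, add_zero] at this
    · rw [hσ, if_pos (fst_matching_eq_of_ne_root hm hb)]
  have hroot : ∀ i, lapApply (T i) (fun b => x ⟨i, b⟩) (r i)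
      = if (m ⟨i, r i⟩).1 = i then 2 * x ⟨i, r i⟩ else 0 := by
    intro i
    rw [funext (hprop i), lapApply_const_mul, hσ]
    split_ifs
    · linear_combination 2 * x ⟨i, r i⟩ * hsq i (r i)
    · ring
  -- `P i` marks the cycle edge leaving root `i` forward as matched; `P (i - 1)` concerns the edge
  -- arriving there.
  let P : Fin (n + 3) → Prop := fun i => m ⟨i, r i⟩ = ⟨i + 1, r (i + 1)⟩
  have hP : ∀ i, P (i - 1) ↔ m ⟨i - 1, r (i - 1)⟩ = ⟨i, r i⟩ := by
    intro i
    simp only [P]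
    rw [sub_add_cancel]
  have hne : ∀ i, (m ⟨i, r i⟩).1 ≠ i ↔ P i ∨ P (i - 1) := by
    intro i
    rw [fst_matching_root_ne_iff hm hinv, hP]
  have hdisj : ∀ i, P i → ¬ P (i - 1) := fun i h => by
    rw [hP]
    exact not_matching_root_both hinv i h
  let ε : Fin (n + 3) → ℝ := fun i => if P i then -1 else 1
  -- At a root matched inside its tree, the tree part already gives `2 * x` and both signs are 1;
  -- otherwise it gives 0 and the two signs cancel.
  have hrec : ∀ i, x ⟨i + 1, r (i + 1)⟩ + x ⟨i - 1, r (i - 1)⟩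
      = (ε (i - 1) + ε i) * x ⟨i, r i⟩ := by
    intro i
    have h := hLx ⟨i, r i⟩
    rw [lapApply_cycleOfTrees, if_pos rfl, hroot] at h
    have h1 := hne i
    have h2 := hdisj i
    simp only [ε]
    by_cases hi : P i
    · rw [if_neg (h1.2 (Or.inl hi))] at h
      rw [if_pos hi, if_neg (h2 hi)]
      linarith
    · by_cases hi' : P (i - 1)
      · rw [if_neg (h1.2 (Or.inr hi'))] at h
        rw [if_neg hi, if_pos hi']
        linarith
      · rw [if_pos (by_contra fun hc => (h1.1 hc).elim hi hi')] at h
        rw [if_neg hi, if_neg hi']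
        linarith
  have hprod : ∏ i, ε i ≠ -1 := by
    refine prod_sign_ne_neg_one_of_cyclic_recursion (x := fun i => x ⟨i, r i⟩)
      (fun i => by simp only [ε]; split_ifs <;> norm_num) (fun i => ?_) (fun h0 => hx ?_)
    · have h := hrec (i + 1)
      rwa [add_sub_cancel_right] at h
    · ext ⟨i, a⟩
      have h1 : x ⟨i, r i⟩ = 0 := congrFun h0 i
      rw [hprop, h1]
      simp
  -- Each matched cycle edge is counted at both its ends, and no root is an end of two.
  have hcard : numOddOrder V = 2 * (Finset.univ.filter P).card := by
    have h1 : (Finset.univ.filter fun i => Odd (Fintype.card (V i)))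
        = Finset.univ.filter P ∪ Finset.univ.filter fun i => P (i - 1) := by
      ext i
      simp only [Finset.mem_filter, Finset.mem_univ, true_and, Finset.mem_union]
      rw [odd_card_iff_fst_matching_root_ne hm hinv, hne]
    have h2 : (Finset.univ.filter fun i => P (i - 1)).card = (Finset.univ.filter P).card :=
      Finset.card_bij (fun i _ => i - 1) (by simp) (fun a _ b _ h => by simpa using h)
        (fun b hb => ⟨b + 1, by simpa using hb, by simp⟩)
    have h3 : numOddOrder V = (Finset.univ.filter fun i => Odd (Fintype.card (V i))).card := by
      unfold numOddOrder
      congr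
    rw [h3, h1, Finset.card_union_of_disjoint, h2, two_mul]
    rw [Finset.disjoint_filter]
    exact fun i _ h => hdisj i h
  have heven : Even (Finset.univ.filter P).card := by
    by_contra h
    apply hprod
    simp only [ε]
    rw [Finset.prod_ite, Finset.prod_const, Finset.prod_const_one, mul_one]
    exact (Nat.not_even_iff_odd.1 h).neg_one_pow
  obtain ⟨k, hk⟩ := heven
  rw [hcard, hk, Nat.modEq_zero_iff_dvd]
  exact ⟨k, by ring⟩

end Matching

/-! ### Transport along isomorphisms and conclusion -/

theorem numOddOrder_modEq_zero_of_iso {g : ℕ} (hg : 3 ≤ g) {V : Fin g → Type*}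
    [∀ i, Fintype (V i)] {T : ∀ i, SimpleGraph (V i)} (hT : ∀ i, (T i).IsTree) {r : ∀ i, V i}
    {W : Type*} [Fintype W] {G : SimpleGraph W} (φ : G ≃g cycleOfTrees T r)
    (hM : HasPerfectMatching G) (hL : HasLaplacianEigenvalue G 2) :
    numOddOrder V ≡ 0 [MOD 4] := by
  obtain ⟨n, rfl⟩ := Nat.exists_eq_add_of_le' hg
  obtain ⟨m, hm, hinv⟩ := hM.exists_involution
  obtain ⟨x, hx, hLx⟩ := (hasLaplacianEigenvalue_iff G 2).1 hL
  refine numOddOrder_modEq_zero hT (r := r) (m := fun p => φ (m (φ.symm p))) (fun p => ?_)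
    (fun p => ?_) (x := x ∘ φ.symm) (fun h0 => hx ?_) (fun p => ?_)
  · have := φ.map_adj_iff.2 (hm (φ.symm p))
    rwa [φ.apply_symm_apply] at this
  · simp [hinv]
  · ext w
    simpa using congrFun h0 (φ w)
  · rw [lapApply_comp_iso, hLx]
    rfl

theorem mainTheorem1 {g₁ g₂ : ℕ} (hg₁ : 3 ≤ g₁) (hg₂ : 3 ≤ g₂)
    {V₁ : Fin g₁ → Type*} {V₂ : Fin g₂ → Type*}
    [∀ i, Fintype (V₁ i)] [∀ j, Fintype (V₂ j)]
    (T₁ : ∀ i, SimpleGraph (V₁ i)) (T₂ : ∀ j, SimpleGraph (V₂ j))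
    (hT₁ : ∀ i, (T₁ i).IsTree) (hT₂ : ∀ j, (T₂ j).IsTree)
    (r₁ : ∀ i, V₁ i) (r₂ : ∀ j, V₂ j)
    {W₁ W₂ : Type*} [Fintype W₁] [Fintype W₂]
    (G₁ : SimpleGraph W₁) (G₂ : SimpleGraph W₂)
    (φ₁ : G₁ ≃g cycleOfTrees T₁ r₁) (φ₂ : G₂ ≃g cycleOfTrees T₂ r₂)
    (hM₁ : HasPerfectMatching G₁) (hM₂ : HasPerfectMatching G₂)
    (hL₁ : HasLaplacianEigenvalue G₁ 2) (hL₂ : HasLaplacianEigenvalue G₂ 2)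
    (u : W₁) (v : W₂) :
    (numOddOrder V₁ ≡ 0 [MOD 4] ∧ numOddOrder V₂ ≡ 0 [MOD 4]) ↔
      HasLaplacianEigenvalue (oneEdgeConnection G₁ G₂ u v) 2 := by
  constructor
  · exact fun _ => hL₁.oneEdgeConnection hL₂ u v
  · exact fun _ => ⟨numOddOrder_modEq_zero_of_iso hg₁ hT₁ φ₁ hM₁ hL₁,
      numOddOrder_modEq_zero_of_iso hg₂ hT₂ φ₂ hM₂ hL₂⟩
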